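/- Let $M$ be a smooth manifold of dimension $p+q$ with a smooth foliation $\mathcal F$ of dimension $p$ and codimension $q$, and let $N=TM/T\mathcal F$ be its normal bundle. A section of $N$ is foliated if it is locally represented by infinitesimal automorphisms of $\mathcal F$, i.e. by vector fields $Y$ with $[X,Y]\in T\mathcal F$ for all $X$ tangent to $\mathcal F$; a connection $D$ in $N$ is normal if $D_Xs=0$ for $X\in T\mathcal F$ and $s$ foliated. Write $\bar X$ for the section of $N$ represented by a vector field $X$. A normal connection $D$ is torsion-free if $D_X\bar Y-D_Y\bar X=\overline{[X,Y]}$. An adapted chart is a chart $(x^1,\dots,x^p,y^1,\dots,y^q)$ of $M$ in which $T\mathcal F=\ker dy$; an adapted foliated affine coordinate system for $D$ is an adapted chart in which the sections $\overline{\partial/\partial y^i}$ of $N$ are $D$-parallel. A function is basic if it is smooth and constant along the leaves (annihilated by $T\mathcal F$). Let $(D,g)$ be a normal Hessian structure on $(M,\mathcal F)$: $D$ is a flat torsion-free normal connection in $N$ and $g$ is a Riemannian metric in $N$ such that around each point there are an adapted foliated affine coordinate system and a basic function $h$ with $g_{ij}:=g(\overline{\partial/\partial y^i},\overline{\partial/\partial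 y^j})=\partial^2h/\partial y^i\partial y^j$. Let $\nabla$ be the normal Levi-Civita connection of $g$ (the torsion-free normal connection with $Xg(s,t)=g(\nabla_Xs,t)+g(s,\nabla_Xt)$), let $\gamma=\nabla-D$ be the difference tensor, and let $Q=D\gamma$ be the normal Hessian curvature tensor, i.e. $(D_X\gamma)(s,t)=D_X(\gamma(s,t))-\gamma(D_Xs,t)-\gamma(s,D_Xt)$. Its components are defined by $Q^m_{jkl}\,\overline{\partial/\partial y^m}=(D_{\partial/\partial y^k}\gamma)(\overline{\partial/\partial y^j},\overline{\partial/\partial y^l})$ and $Q_{ijkl}=g_{im}Q^m_{jkl}$ (summation over repeated indices). **Proposition.** Let $(x^1,\dots,x^p,y^1,\dots,y^q)$ be an adapted foliated affine coordinate system, and suppose that on its domain $g_{ij}=\dfrac{\partial^2\varphi}{\partial y^i\partial y^j}$ for some basic function $\varphi$. Let $(g^{rs})$ be the inverse matrix of $(g_{ij})$. Then on this domain, for all $i,j,k,l=1,\dots,q$: (1) $\displaystyle Q_{ijkl}=\frac12\frac{\partial^4\varphi}{\partial y^i\partial y^j\partial y^k\partial y^l}-\frac12\,g^{rs}\,\frac{\partial^3\varphi}{\partial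 y^i\partial y^k\partial y^r}\,\frac{\partial^3\varphi}{\partial y^j\partial y^l\partial y^s}$; (2) $Q_{ijkl}=Q_{klij}=Q_{kjil}=Q_{ilkj}=Q_{jilk}$. -/

import Mathlib

open scoped Manifold ContDiff Bundle

noncomputable section

namespace FoliatedHessian

/-- The model space `ℝ^p × ℝ^q` of a `(p+q)`-manifold with a foliation of dimension `p` and
codimension `q`: the coordinates are `(x^1, …, x^p, y^1, …, y^q)`. -/
abbrev Model (p q : ℕ) : Type := (Fin p → ℝ) × (Fin q → ℝ)

/-- The model with corners of boundaryless manifolds modelled on `ℝ^p × ℝ^q`. -/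
abbrev mdl (p q : ℕ) : ModelWithCorners ℝ (Model p q) (Model p q) := 𝓘(ℝ, Model p q)

/-- A vector field on `M` (no regularity). -/
abbrev VField (p q : ℕ) (M : Type*) [TopologicalSpace M] [ChartedSpace (Model p q) M] : Type _ :=
  ∀ z : M, TangentSpace (mdl p q) z

/-- The vector field `X` is smooth on `U`. -/
def SmoothVField {p q : ℕ} {M : Type*} [TopologicalSpace M] [ChartedSpace (Model p q) M]
    [IsManifold (mdl p q) ∞ M] (X : VField p q M) (U : Set M) : Prop :=
  ContMDiffOn (mdl p q) (mdl p q).tangent ∞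
    (fun z => (⟨z, X z⟩ : TangentBundle (mdl p q) M)) U

/-- A smooth foliation of dimension `p` and codimension `q`, given by its tangent distribution
`TF ⊆ TM`, which is integrable: around every point there is a smooth chart `(x, y)` of `M` in
which `TF` is spanned by `∂/∂x^1, …, ∂/∂x^p`, i.e. is the kernel of `dy`. -/
structure Foliation (p q : ℕ) (M : Type*) [TopologicalSpace M] [ChartedSpace (Model p q) M]
    [IsManifold (mdl p q) ∞ M] where
  /-- the tangent spaces of the leaves -/
  tangent : ∀ z : M, Submodule ℝ (TangentSpace (mdl p q) z)
  exists_adapted : ∀ z : M, ∃ e ∈ IsManifold.maximalAtlas (mdl p q) ∞ M, z ∈ e.source ∧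
    ∀ w ∈ e.source, ∀ v : TangentSpace (mdl p q) w,
      v ∈ tangent w ↔ (mfderiv (mdl p q) (mdl p q) e w v : Model p q).2 = 0

variable {p q : ℕ} {M : Type*} [TopologicalSpace M] [ChartedSpace (Model p q) M]
  [IsManifold (mdl p q) ∞ M]

/-! ### Charts and partial derivatives -/

/-- The transverse coordinate vector field `∂/∂y^k` of a chart `e = (x, y)` (meaningful on
`e.source`). -/
def coordField (e : OpenPartialHomeomorph M (Model p q)) (k : Fin q) : VField p q M :=
  VectorField.mpullback (mdl p q) (mdl p q) e fun _ => ((0, Pi.single k 1) : Model p q)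

/-- The partial derivative `∂f/∂y^k` of a function on `M` in the chart `e = (x, y)`. -/
def pderiv (e : OpenPartialHomeomorph M (Model p q)) (k : Fin q) (f : M → ℝ) : M → ℝ :=
  fun z => fderiv ℝ (f ∘ e.symm) (e z) (0, Pi.single k 1)

namespace Foliation

/-- An adapted chart: a smooth chart `(x, y)` of `M` with `TF = ker dy` on its domain. -/
def IsAdapted (F : Foliation p q M) (e : OpenPartialHomeomorph M (Model p q)) : Prop :=
  e ∈ IsManifold.maximalAtlas (mdl p q) ∞ M ∧ ∀ w ∈ e.source,
    ∀ v : TangentSpace (mdl p q) w,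
      v ∈ F.tangent w ↔ (mfderiv (mdl p q) (mdl p q) e w v : Model p q).2 = 0

/-- A basic function on `U`: smooth, and constant along the leaves. -/
def IsBasicOn (F : Foliation p q M) (f : M → ℝ) (U : Set M) : Prop :=
  ContMDiffOn (mdl p q) 𝓘(ℝ, ℝ) ∞ f U ∧
    ∀ z ∈ U, ∀ v ∈ F.tangent z, mvfderiv (mdl p q) f z v = 0

/-! ### The normal bundle -/

/-- The fibre at `z` of the normal bundle `N(M, F) = TM / TF`. -/
abbrev Normal (F : Foliation p q M) (z : M) : Type := TangentSpace (mdl p q) z ⧸ F.tangent z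

/-- A section of the normal bundle (no regularity). -/
abbrev NSection (F : Foliation p q M) : Type _ := ∀ z : M, F.Normal z

/-- The section of the normal bundle represented by a vector field. -/
def bar (F : Foliation p q M) (X : VField p q M) : F.NSection :=
  fun z => (F.tangent z).mkQ (X z)

/-- A section of the normal bundle is smooth on the (open) set `U` if it is locally represented by
smooth vector fields. -/
def SmoothSection (F : Foliation p q M) (s : F.NSection) (U : Set M) : Prop :=
  ∀ z ∈ U, ∃ (V : Set M) (Y : VField p q M), IsOpen V ∧ z ∈ V ∧ SmoothVField Y V ∧
    ∀ w ∈ V, s w = F.bar Y w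

/-- `Y` is an infinitesimal automorphism of the foliation on the open set `U`: it is smooth, and
`[X, Y]` is tangent to the leaves whenever `X` is. -/
def IsInfAut (F : Foliation p q M) (Y : VField p q M) (U : Set M) : Prop :=
  SmoothVField Y U ∧ ∀ (V : Set M) (X : VField p q M), IsOpen V → V ⊆ U → SmoothVField X V →
    (∀ w ∈ V, X w ∈ F.tangent w) → ∀ w ∈ V, VectorField.mlieBracket (mdl p q) X Y w ∈ F.tangent w

/-- A foliated section of the normal bundle over the open set `U`: locally represented by
infinitesimal automorphisms. -/
def FoliatedSection (F : Foliation p q M) (s : F.NSection) (U : Set M) : Prop :=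
  ∀ z ∈ U, ∃ (V : Set M) (Y : VField p q M), IsOpen V ∧ z ∈ V ∧ F.IsInfAut Y V ∧
    ∀ w ∈ V, s w = F.bar Y w

/-- A linear right inverse `TM / TF → TM` of the projection at each point, i.e. a choice of
supplement of `TF` at each point. It is only used in arguments that are tensorial and vanish
on `TF`, where the choice does not matter. -/
def lift (F : Foliation p q M) (z : M) : F.Normal z →ₗ[ℝ] TangentSpace (mdl p q) z :=
  ((F.tangent z).mkQ.exists_rightInverse_of_surjective
    (LinearMap.range_eq_top.2 (F.tangent z).mkQ_surjective)).choose

theorem mkQ_lift (F : Foliation p q M) (z : M) (u : F.Normal z) :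
    (F.tangent z).mkQ (F.lift z u) = u :=
  LinearMap.congr_fun ((F.tangent z).mkQ.exists_rightInverse_of_surjective
    (LinearMap.range_eq_top.2 (F.tangent z).mkQ_surjective)).choose_spec u

end Foliation

/-! ### Connections and metrics in the normal bundle -/

/-- A normal connection: a smooth connection in the normal bundle with `D_X s = 0` for `s` foliated
and `X` tangent to the leaves. Here `D s z v` is `D_v s` for a tangent vector `v` of `M` at `z`; it
is meaningful for sections `s` that are smooth near `z`. -/
structure NormalConnection (F : Foliation p q M) where
  toFun : F.NSection → ∀ z : M, TangentSpace (mdl p q) z →ₗ[ℝ] F.Normal z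
  add : ∀ (U : Set M) (s t : F.NSection), IsOpen U → F.SmoothSection s U → F.SmoothSection t U →
    ∀ z ∈ U, toFun (fun w => s w + t w) z = toFun s z + toFun t z
  leibniz : ∀ (U : Set M) (f : M → ℝ) (s : F.NSection), IsOpen U →
    ContMDiffOn (mdl p q) 𝓘(ℝ, ℝ) ∞ f U → F.SmoothSection s U →
    ∀ z ∈ U, ∀ v : TangentSpace (mdl p q) z,
      toFun (fun w => f w • s w) z v = mvfderiv (mdl p q) f z v • s z + f z • toFun s z v
  smooth : ∀ (U : Set M) (X : VField p q M) (s : F.NSection), IsOpen U → SmoothVField X U →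
    F.SmoothSection s U → F.SmoothSection (fun w => toFun s w (X w)) U
  normal : ∀ (U : Set M) (s : F.NSection), IsOpen U → F.FoliatedSection s U →
    ∀ z ∈ U, ∀ v ∈ F.tangent z, toFun s z v = 0

namespace NormalConnection

variable {F : Foliation p q M}

/-- The section `D_X s`. -/
def along (D : NormalConnection F) (X : VField p q M) (s : F.NSection) : F.NSection :=
  fun w => D.toFun s w (X w)

/-- `D_X Ȳ - D_Y X̄` is the class of `[X, Y]`. -/
def IsTorsionFree (D : NormalConnection F) : Prop :=
  ∀ (U : Set M) (X Y : VField p q M), IsOpen U → SmoothVField X U → SmoothVField Y U → ∀ z ∈ U,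
    D.along X (F.bar Y) z - D.along Y (F.bar X) z =
      F.bar (VectorField.mlieBracket (mdl p q) X Y) z

/-- The curvature `R_D(X, Y) s = D_X D_Y s - D_Y D_X s - D_[X,Y] s` vanishes. -/
def IsFlat (D : NormalConnection F) : Prop :=
  ∀ (U : Set M) (X Y : VField p q M) (s : F.NSection), IsOpen U → SmoothVField X U →
    SmoothVField Y U → F.SmoothSection s U → ∀ z ∈ U,
    D.along X (D.along Y s) z - D.along Y (D.along X s) z -
      D.along (VectorField.mlieBracket (mdl p q) X Y) s z = 0

/-- An adapted foliated affine coordinate system `(x, y)` for `D`: an adapted chart such that the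
classes of `∂/∂y^1, …, ∂/∂y^q` in the normal bundle are `D`-parallel. -/
def IsAffineChart (D : NormalConnection F) (e : OpenPartialHomeomorph M (Model p q)) : Prop :=
  F.IsAdapted e ∧ ∀ k, ∀ z ∈ e.source, D.toFun (F.bar (coordField e k)) z = 0

end NormalConnection

/-- A Riemannian metric in the normal bundle. -/
structure NormalMetric (F : Foliation p q M) where
  toFun : ∀ z : M, F.Normal z →ₗ[ℝ] F.Normal z →ₗ[ℝ] ℝ
  symm : ∀ z u v, toFun z u v = toFun z v u
  pos : ∀ z u, u ≠ 0 → 0 < toFun z u u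
  smooth : ∀ (U : Set M) (s t : F.NSection), IsOpen U → F.SmoothSection s U →
    F.SmoothSection t U → ContMDiffOn (mdl p q) 𝓘(ℝ, ℝ) ∞ (fun w => toFun w (s w) (t w)) U

/-- The components `g_ij = g(∂/∂y^i, ∂/∂y^j)` of a normal metric in a chart. -/
def NormalMetric.comp {F : Foliation p q M} (g : NormalMetric F)
    (e : OpenPartialHomeomorph M (Model p q)) (i j : Fin q) : M → ℝ :=
  fun z => g.toFun z (F.bar (coordField e i) z) (F.bar (coordField e j) z)

/-- The entries `g^rs` of the inverse of the matrix `(g_ij)`. -/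
def NormalMetric.compInv {F : Foliation p q M} (g : NormalMetric F)
    (e : OpenPartialHomeomorph M (Model p q)) (r s : Fin q) : M → ℝ :=
  fun z => (Matrix.of fun i j => g.comp e i j z)⁻¹ r s

/-- `nabla` is the (normal) Levi-Civita connection of `g`: it is torsion-free, and
`X g(s, t) = g(∇_X s, t) + g(s, ∇_X t)`. -/
def NormalConnection.IsLeviCivita {F : Foliation p q M} (nabla : NormalConnection F)
    (g : NormalMetric F) : Prop :=
  nabla.IsTorsionFree ∧
  ∀ (U : Set M) (s t : F.NSection), IsOpen U → F.SmoothSection s U → F.SmoothSection t U →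
    ∀ z ∈ U, ∀ v : TangentSpace (mdl p q) z,
      mvfderiv (mdl p q) (fun w => g.toFun w (s w) (t w)) z v =
        g.toFun z (nabla.toFun s z v) (t z) + g.toFun z (s z) (nabla.toFun t z v)

/-- `φ` is a basic function on the domain of the chart `e = (x, y)` and
`g_ij = ∂²φ / ∂y^i ∂y^j` there. -/
def NormalMetric.IsPotential {F : Foliation p q M} (g : NormalMetric F)
    (e : OpenPartialHomeomorph M (Model p q)) (φ : M → ℝ) : Prop :=
  F.IsBasicOn φ e.source ∧
    ∀ z ∈ e.source, ∀ i j, g.comp e i j z = pderiv e i (pderiv e j φ) z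

/-- A normal Hessian structure `(D, g)`: a flat torsion-free normal connection and a normal metric
which, near every point, is the Hessian of a basic function in an adapted foliated affine
coordinate system. -/
structure HessianStructure (F : Foliation p q M) where
  D : NormalConnection F
  g : NormalMetric F
  torsionFree : D.IsTorsionFree
  flat : D.IsFlat
  hessian : ∀ z : M, ∃ (e : OpenPartialHomeomorph M (Model p q)) (φ : M → ℝ),
    D.IsAffineChart e ∧ z ∈ e.source ∧ g.IsPotential e φ

/-! ### The difference tensor and the Hessian curvature tensor -/

/-- The difference tensor `γ = ∇ - D`: the section `γ(s, t) = ∇_s t - D_s t`. Since both connections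
are normal, `∇_v t - D_v t` depends only on the class of `v` in the normal bundle. -/
def differenceTensor {F : Foliation p q M} (D nabla : NormalConnection F) (s t : F.NSection) :
    F.NSection :=
  fun w => nabla.toFun t w (F.lift w (s w)) - D.toFun t w (F.lift w (s w))

/-- The normal Hessian curvature tensor `Q = Dγ`:
`(D_X γ)(s, t) = D_X (γ(s, t)) - γ(D_X s, t) - γ(s, D_X t)`. -/
def hessianCurvature {F : Foliation p q M} (D nabla : NormalConnection F)
    (X : VField p q M) (s t : F.NSection) : F.NSection :=
  fun z => D.along X (differenceTensor D nabla s t) z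
    - differenceTensor D nabla (D.along X s) t z - differenceTensor D nabla s (D.along X t) z

/-- The components `Q_ijkl = g_im Q^m_jkl`, where
`Q^m_jkl ∂/∂y^m = (D_{∂/∂y^k} γ)(∂/∂y^j, ∂/∂y^l)`. -/
def hessianCurvatureComp {F : Foliation p q M} (g : NormalMetric F) (D nabla : NormalConnection F)
    (e : OpenPartialHomeomorph M (Model p q)) (i j k l : Fin q) : M → ℝ :=
  fun z => g.toFun z (F.bar (coordField e i) z)
    (hessianCurvature D nabla (coordField e k) (F.bar (coordField e j)) (F.bar (coordField e l)) z)

end FoliatedHessian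

end

namespace FoliatedHessian

/-! In an affine chart the classes of the `∂/∂y^m` form a `D`-parallel frame of the normal bundle,
so the components of `γ = ∇ - D` are the Christoffel symbols of `∇`, and those of `Q = Dγ` are their
partial derivatives `∂_k Γ^m_jl` (`hessianCurvature_coordField`). Since `g_ij = φ_ij`, every first
derivative of the metric is a third derivative of `φ`, fully symmetric in its indices, and the
Koszul formula collapses to `g_im Γ^m_jl = ½ φ_ijl` (`metric_leviCivita_coordField`).

The inverse matrix is never differentiated. Applying `∂_k` to this lowered identity gives `½ φ_ijkl
= φ_ikm Γ^m_jl + Q_ijkl`, and substituting `Γ^m_jl = ½ g^{ms} φ_jls` gives (1), in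
`hessianCurvatureComp_eq`. The symmetries (2) follow from (1), because partial derivatives commute
and `g^{rs}` is symmetric.

The remaining work is to justify computing in the frame: connections act on arbitrary global
sections, so their locality has to be extracted from the axioms (`toFun_eq_zero`, `toFun_congr`),
and the lift chosen in `γ` has to be shown irrelevant (`toFun_lift_bar`). -/

theorem two_le_infty : (2 : ℕ∞ω) ≤ ∞ := by norm_cast

variable {p q : ℕ} {M : Type*} [TopologicalSpace M] [ChartedSpace (Model p q) M]

/-- The vector field which has constant components `c` in the chart `e` (meaningful on
`e.source`). -/
noncomputable def constField (e : OpenPartialHomeomorph M (Model p q)) (c : Model p q) :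
    VField p q M :=
  VectorField.mpullback (mdl p q) (mdl p q) e fun _ => c

theorem coordField_eq_constField (e : OpenPartialHomeomorph M (Model p q)) (k : Fin q) :
    coordField e k = constField e (0, Pi.single k 1) := rfl

/-! ### Iterated partial derivatives depend only on values in the chart domain -/

section Transverse

variable {M : Type*} [TopologicalSpace M] {e : OpenPartialHomeomorph M (Model p q)}

/-- Iterating `pderiv` inserts `e ∘ e.symm` between the two derivatives. This is the identity only
on `e.target`, which is open, so it disappears after passing to germs. -/
theorem fderiv_pderiv_comp_symm {f : M → ℝ} {k : Fin q} {x : Model p q} (hx : x ∈ e.target) :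
    fderiv ℝ (pderiv e k f ∘ e.symm) x =
      fderiv ℝ (fun y => fderiv ℝ (f ∘ e.symm) y (0, Pi.single k 1)) x := by
  apply Filter.EventuallyEq.fderiv_eq
  filter_upwards [e.open_target.mem_nhds hx] with y hy
  simp [pderiv, e.right_inv hy]

theorem pderiv_congr {f f' : M → ℝ} (h : Set.EqOn f f' e.source) {z : M} (hz : z ∈ e.source)
    (k : Fin q) : pderiv e k f z = pderiv e k f' z := by
  have : f ∘ e.symm =ᶠ[nhds (e z)] f' ∘ e.symm := by
    filter_upwards [e.open_target.mem_nhds (e.map_source hz)] with y hy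
    exact h (e.map_target hy)
  simp only [pderiv, this.fderiv_eq]

end Transverse

/-! ### Constant-coefficient fields and partial derivatives in a smooth chart -/

section Chart

variable {e : OpenPartialHomeomorph M (Model p q)}
  (he : e ∈ IsManifold.maximalAtlas (mdl p q) ∞ M)

include he

theorem contMDiffAt_chart {z : M} (hz : z ∈ e.source) :
    ContMDiffAt (mdl p q) (mdl p q) ∞ e z :=
  contMDiffAt_of_mem_maximalAtlas he hz

theorem chart_mdifferentiable : e.MDifferentiable (mdl p q) (mdl p q) :=
  ⟨fun _ hz => ((contMDiffAt_of_mem_maximalAtlas he hz).mdifferentiableAt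
      (by simp)).mdifferentiableWithinAt,
    fun _ hz => ((contMDiffAt_symm_of_mem_maximalAtlas he hz).mdifferentiableAt
      (by simp)).mdifferentiableWithinAt⟩

theorem isInvertible_mfderiv_chart {z : M} (hz : z ∈ e.source) :
    (mfderiv (mdl p q) (mdl p q) e z).IsInvertible :=
  ⟨(chart_mdifferentiable he).mfderiv hz, rfl⟩

theorem mfderiv_constField {z : M} (hz : z ∈ e.source) (c : Model p q) :
    mfderiv (mdl p q) (mdl p q) e z (constField e c z) = c :=
  (isInvertible_mfderiv_chart he hz).self_apply_inverse c

theorem smoothVField_constField [IsManifold (mdl p q) ∞ M] (c : Model p q) : SmoothVField (constField e c) e.source := by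
  intro z hz
  have hV : ContMDiffAt (mdl p q) (mdl p q).tangent ∞
      (fun x : Model p q => (⟨x, c⟩ : TangentBundle (mdl p q) (Model p q))) (e z) :=
    contMDiffAt_vectorSpace_iff_contDiffAt.2 contDiffAt_const
  exact (ContMDiffAt.mpullback_vectorField_preimage hV (contMDiffAt_chart he hz)
    (isInvertible_mfderiv_chart he hz) (by simp)).contMDiffWithinAt

/-- The bracket is natural under pullback, and constant fields on a vector space commute. -/
theorem mlieBracket_constField [IsManifold (mdl p q) ∞ M] {z : M} (hz : z ∈ e.source) (c d : Model p q) :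
    VectorField.mlieBracket (mdl p q) (constField e c) (constField e d) z = 0 := by
  have hV (c : Model p q) : MDifferentiableAt (mdl p q) (mdl p q).tangent
      (fun x : Model p q => (⟨x, c⟩ : TangentBundle (mdl p q) (Model p q))) (e z) := by
    have : ContMDiffAt (mdl p q) (mdl p q).tangent ∞
        (fun x : Model p q => (⟨x, c⟩ : TangentBundle (mdl p q) (Model p q))) (e z) :=
      contMDiffAt_vectorSpace_iff_contDiffAt.2 contDiffAt_const
    exact this.mdifferentiableAt (by simp)
  have h2 : minSmoothness ℝ 2 ≤ ∞ := by simpa using two_le_infty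
  have : IsManifold (mdl p q) (minSmoothness ℝ 2) M := IsManifold.of_le h2
  have h := VectorField.mpullback_mlieBracket (hV c) (hV d) (contMDiffAt_chart he hz)
    h2
  have h1 : VectorField.mlieBracket (mdl p q) (fun _ : Model p q => c) (fun _ => d) (e z) =
      VectorField.lieBracketWithin ℝ (fun _ : Model p q => c) (fun _ => d) Set.univ (e z) :=
    congrFun (VectorField.mlieBracketWithin_univ.symm.trans
      VectorField.mlieBracketWithin_eq_lieBracketWithin) (e z)
  have h0 : VectorField.lieBracketWithin ℝ (fun _ : Model p q => c) (fun _ => d) Set.univ (e z)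
      = 0 := by
    simp [VectorField.lieBracket]
  exact h.symm.trans ((congrArg _ (h1.trans h0)).trans (map_zero _))

theorem contDiffOn_comp_symm {f : M → ℝ} (hf : ContMDiffOn (mdl p q) 𝓘(ℝ, ℝ) ∞ f e.source) :
    ContDiffOn ℝ ∞ (f ∘ e.symm) e.target := by
  rw [← contMDiffOn_iff_contDiffOn]
  exact hf.comp (contMDiffOn_symm_of_mem_maximalAtlas he) e.mapsTo_symm

theorem contMDiffOn_pderiv {f : M → ℝ} (hf : ContMDiffOn (mdl p q) 𝓘(ℝ, ℝ) ∞ f e.source)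
    (k : Fin q) : ContMDiffOn (mdl p q) 𝓘(ℝ, ℝ) ∞ (pderiv e k f) e.source := by
  have h1 : ContDiffOn ℝ ∞ (fun x => fderiv ℝ (f ∘ e.symm) x (0, Pi.single k 1)) e.target :=
    ((contDiffOn_comp_symm he hf).fderiv_of_isOpen e.open_target (by simp)).clm_apply
      contDiffOn_const
  exact (contMDiffOn_iff_contDiffOn.2 h1).comp (contMDiffOn_of_mem_maximalAtlas he) e.mapsTo

theorem pderiv_comm {f : M → ℝ} (hf : ContMDiffOn (mdl p q) 𝓘(ℝ, ℝ) ∞ f e.source)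
    {z : M} (hz : z ∈ e.source) (j k : Fin q) :
    pderiv e j (pderiv e k f) z = pderiv e k (pderiv e j f) z := by
  have hx := e.map_source hz
  have hc : ContDiffAt ℝ ∞ (f ∘ e.symm) (e z) :=
    (contDiffOn_comp_symm he hf).contDiffAt (e.open_target.mem_nhds hx)
  have hd : DifferentiableAt ℝ (fderiv ℝ (f ∘ e.symm)) (e z) :=
    (hc.fderiv_right (m := 1) (by norm_cast)).differentiableAt (by simp)
  have hs : IsSymmSndFDerivAt ℝ (f ∘ e.symm) (e z) :=
    hc.isSymmSndFDerivAt (by simpa using two_le_infty)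
  have key (a b : Model p q) : fderiv ℝ (fun y => fderiv ℝ (f ∘ e.symm) y a) (e z) b =
      fderiv ℝ (fderiv ℝ (f ∘ e.symm)) (e z) b a := by
    rw [fderiv_clm_apply hd (differentiableAt_const a)]
    simp
  change fderiv ℝ (pderiv e k f ∘ e.symm) (e z) _ = fderiv ℝ (pderiv e j f ∘ e.symm) (e z) _
  rw [fderiv_pderiv_comp_symm (e := e) (f := f) (k := k) hx,
    fderiv_pderiv_comp_symm (e := e) (f := f) (k := j) hx, key, key]
  exact hs _ _

/-- Chain rule for `f = (f ∘ e.symm) ∘ e` near `z`. This links the intrinsic derivative in the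
connection axioms to the coordinate derivatives in the formula. -/
theorem mvfderiv_coordField {f : M → ℝ} (hf : ContMDiffOn (mdl p q) 𝓘(ℝ, ℝ) ∞ f e.source)
    {z : M} (hz : z ∈ e.source) (k : Fin q) :
    mvfderiv (mdl p q) f z (coordField e k z) = pderiv e k f z := by
  have hx := e.map_source hz
  have hc : ContDiffAt ℝ ∞ (f ∘ e.symm) (e z) :=
    (contDiffOn_comp_symm he hf).contDiffAt (e.open_target.mem_nhds hx)
  have hmd : MDifferentiableAt (mdl p q) 𝓘(ℝ, ℝ) (f ∘ e.symm) (e z) :=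
    (hc.differentiableAt (by simp)).mdifferentiableAt
  have heq : f =ᶠ[nhds z] (f ∘ e.symm) ∘ e := by
    filter_upwards [e.open_source.mem_nhds hz] with y hy
    simp [e.left_inv hy]
  have h1 : mfderiv (mdl p q) 𝓘(ℝ, ℝ) f z =
      (mfderiv (mdl p q) 𝓘(ℝ, ℝ) (f ∘ e.symm) (e z)).comp (mfderiv (mdl p q) (mdl p q) e z) := by
    rw [← mfderiv_comp z hmd ((chart_mdifferentiable he).mdifferentiableAt hz)]
    exact heq.mfderiv_eq
  have h2 : mvfderiv (mdl p q) f z (coordField e k z) =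
      mfderiv (mdl p q) 𝓘(ℝ, ℝ) (f ∘ e.symm) (e z)
        (mfderiv (mdl p q) (mdl p q) e z (coordField e k z)) :=
    congrArg (fun L => L (coordField e k z)) h1
  rw [h2, coordField_eq_constField, mfderiv_constField he hz, mfderiv_eq_fderiv]
  rfl

end Chart

end FoliatedHessian

namespace FoliatedHessian

variable {p q : ℕ} {M : Type*} [TopologicalSpace M] [ChartedSpace (Model p q) M]
  [IsManifold (mdl p q) ∞ M] {F : Foliation p q M}

/-! ### Smooth sections of the normal bundle -/

theorem Foliation.SmoothSection.congr {s t : F.NSection} {U : Set M} (hU : IsOpen U)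
    (hs : F.SmoothSection s U) (h : ∀ z ∈ U, t z = s z) : F.SmoothSection t U := by
  intro z hz
  obtain ⟨V, Y, hV, hzV, hY, hsY⟩ := hs z hz
  exact ⟨V ∩ U, Y, hV.inter hU, ⟨hzV, hz⟩, hY.mono Set.inter_subset_left,
    fun w hw => (h w hw.2).trans (hsY w hw.1)⟩

theorem Foliation.smoothSection_bar {X : VField p q M} {U : Set M} (hU : IsOpen U)
    (hX : SmoothVField X U) : F.SmoothSection (F.bar X) U :=
  fun _ hz => ⟨U, X, hU, hz, hX, fun _ _ => rfl⟩

theorem smoothVField_zero (U : Set M) : SmoothVField (fun _ => 0 : VField p q M) U :=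
  (Bundle.contMDiff_zeroSection ℝ (TangentSpace (mdl p q) : M → Type _)).contMDiffOn

theorem Foliation.smoothSection_zero {U : Set M} (hU : IsOpen U) :
    F.SmoothSection (fun _ => 0) U :=
  (smoothSection_bar hU (smoothVField_zero U)).congr hU fun z _ => by
    simp [bar]

theorem Foliation.smoothSection_sum {ι : Type*} {U : Set M} (hU : IsOpen U) (S : Finset ι)
    {a : ι → M → ℝ} {X : ι → VField p q M}
    (ha : ∀ i, ContMDiffOn (mdl p q) 𝓘(ℝ, ℝ) ∞ (a i) U) (hX : ∀ i, SmoothVField (X i) U) :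
    F.SmoothSection (fun w => ∑ i ∈ S, a i w • F.bar (X i) w) U := by
  have h : SmoothVField (fun w => ∑ i ∈ S, (a i • X i) w) U :=
    ContMDiffOn.sum_section fun i _ => ContMDiffOn.smul_section (ha i) (hX i)
  refine (smoothSection_bar hU h).congr hU fun z _ => ?_
  simp [bar]

/-! ### Locality of normal connections -/

namespace NormalConnection

/-- Locality from the Leibniz rule, without bump functions: the rule only needs its factor to be
smooth on `U`, so the factor may jump at the boundary. -/
theorem toFun_eq_zero (D : NormalConnection F) {s : F.NSection} {U : Set M} (hU : IsOpen U)
    (hs : ∀ w ∈ U, s w = 0) {z : M} (hz : z ∈ U) : D.toFun s z = 0 := by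
  classical
  have hsm : F.SmoothSection s U := (Foliation.smoothSection_zero hU).congr hU hs
  -- Zero on `U` and one outside, so that `f • s = s` globally; at `z` both terms of the Leibniz
  -- rule then vanish.
  let f : M → ℝ := fun w => if w ∈ U then 0 else 1
  have hf : ContMDiffOn (mdl p q) 𝓘(ℝ, ℝ) ∞ f U :=
    (contMDiffOn_const (c := (0 : ℝ))).congr fun w hw => by simp [f, hw]
  have hfs : (fun w => f w • s w) = s := by
    funext w
    by_cases hw : w ∈ U <;> simp [f, hw, hs]
  ext v
  have h := D.leibniz U f s hU hf hsm z hz v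
  rw [hfs] at h
  simpa [hs z hz, f, hz] using h

/-- No smoothness of `s` is assumed: `s - t` vanishes on `U`, hence is smooth there, and additivity
applies to `t + (s - t)`. -/
theorem toFun_congr (D : NormalConnection F) {s t : F.NSection} {U : Set M} (hU : IsOpen U)
    (ht : F.SmoothSection t U) (h : ∀ w ∈ U, s w = t w) {z : M} (hz : z ∈ U) :
    D.toFun s z = D.toFun t z := by
  have h0 : ∀ w ∈ U, s w - t w = 0 := fun w hw => by rw [h w hw, sub_self]
  have hsm : F.SmoothSection (fun w => s w - t w) U :=
    (Foliation.smoothSection_zero hU).congr hU h0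
  have h1 := D.add U t (fun w => s w - t w) hU ht hsm z hz
  rw [D.toFun_eq_zero hU h0 hz, add_zero] at h1
  simpa using h1

theorem toFun_sum (D : NormalConnection F) {ι : Type*} {U : Set M} (hU : IsOpen U) (S : Finset ι)
    {a : ι → M → ℝ} {X : ι → VField p q M}
    (ha : ∀ i, ContMDiffOn (mdl p q) 𝓘(ℝ, ℝ) ∞ (a i) U) (hX : ∀ i, SmoothVField (X i) U)
    {z : M} (hz : z ∈ U) (v : TangentSpace (mdl p q) z) :
    D.toFun (fun w => ∑ i ∈ S, a i w • F.bar (X i) w) z v =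
      ∑ i ∈ S, (mvfderiv (mdl p q) (a i) z v • F.bar (X i) z +
        a i z • D.toFun (F.bar (X i)) z v) := by
  classical
  induction S using Finset.induction_on with
  | empty => simp [D.toFun_eq_zero hU (s := fun _ => 0) (fun _ _ => rfl) hz]
  | insert i S hi ih =>
    have hsi : F.SmoothSection (fun w => a i w • F.bar (X i) w) U := by
      simpa using Foliation.smoothSection_sum (F := F) hU {i} ha hX
    have h := D.add U _ _ hU hsi (Foliation.smoothSection_sum hU S ha hX) z hz
    simp only [Finset.sum_insert hi]
    rw [h, LinearMap.add_apply, ih,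
      D.leibniz U (a i) _ hU (ha i) (Foliation.smoothSection_bar hU (hX i)) z hz v]

end NormalConnection

/-! ### The transverse frame of an adapted chart -/

section Adapted

variable {e : OpenPartialHomeomorph M (Model p q)}

theorem sum_smul_zero_single (b : Fin q → ℝ) :
    ∑ i, b i • ((0, Pi.single i 1) : Model p q) = (0, b) := by
  ext j
  · simp [Prod.fst_sum]
  · simp [Prod.snd_sum, Finset.sum_apply, Pi.single_apply]

theorem smoothVField_coordField (he : e ∈ IsManifold.maximalAtlas (mdl p q) ∞ M) (k : Fin q) :
    SmoothVField (coordField e k) e.source :=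
  smoothVField_constField he _

variable (he : F.IsAdapted e)

include he

theorem constField_mem_tangent {z : M} (hz : z ∈ e.source) {c : Model p q} :
    constField e c z ∈ F.tangent z ↔ c.2 = 0 := by
  rw [he.2 z hz, mfderiv_constField he.1 hz]

theorem mkQ_eq_zero_iff {z : M} (hz : z ∈ e.source) (v : TangentSpace (mdl p q) z) :
    (F.tangent z).mkQ v = 0 ↔ (mfderiv (mdl p q) (mdl p q) e z v : Model p q).2 = 0 := by
  rw [← he.2 z hz, Submodule.mkQ_apply, Submodule.Quotient.mk_eq_zero]

theorem mfderiv_sum_coordField {z : M} (hz : z ∈ e.source) (b : Fin q → ℝ) :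
    (mfderiv (mdl p q) (mdl p q) e z (∑ i, b i • coordField e i z) : Model p q) = (0, b) := by
  rw [map_sum]
  simp only [map_smul, coordField_eq_constField, mfderiv_constField he.1 hz]
  exact sum_smul_zero_single b

/-- Subtracting from `v` its transverse coordinate part leaves a vector in `ker dy`, which is
tangent to the leaves. -/
theorem mkQ_eq_sum {z : M} (hz : z ∈ e.source) (v : TangentSpace (mdl p q) z) :
    (F.tangent z).mkQ v =
      ∑ i, (mfderiv (mdl p q) (mdl p q) e z v : Model p q).2 i • F.bar (coordField e i) z := by
  have h : (F.tangent z).mkQ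
      (v - ∑ i, (mfderiv (mdl p q) (mdl p q) e z v : Model p q).2 i • coordField e i z) = 0 := by
    rw [mkQ_eq_zero_iff he hz, map_sub, mfderiv_sum_coordField he hz]
    exact sub_self _
  rw [map_sub, sub_eq_zero] at h
  rw [h]
  simp [Foliation.bar]

theorem exists_eq_sum_bar {z : M} (hz : z ∈ e.source) (u : F.Normal z) :
    ∃ b : Fin q → ℝ, u = ∑ i, b i • F.bar (coordField e i) z := by
  obtain ⟨v, rfl⟩ := (F.tangent z).mkQ_surjective u
  exact ⟨_, mkQ_eq_sum he hz v⟩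

theorem eq_zero_of_sum_bar_eq_zero {z : M} (hz : z ∈ e.source) {b : Fin q → ℝ}
    (h : ∑ i, b i • F.bar (coordField e i) z = 0) : b = 0 := by
  have h' : (F.tangent z).mkQ (∑ i, b i • coordField e i z) = 0 := by
    rw [← h]
    simp [Foliation.bar]
  rw [mkQ_eq_zero_iff he hz, mfderiv_sum_coordField he hz] at h'
  exact h'

theorem smoothSection_bar_coordField (k : Fin q) :
    F.SmoothSection (F.bar (coordField e k)) e.source :=
  Foliation.smoothSection_bar e.open_source (smoothVField_coordField he.1 k)

/-! ### Torsion-free normal connections in the transverse frame -/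

namespace NormalConnection

variable {D : NormalConnection F} (hD : D.IsTorsionFree)

include hD

/-- The torsion identity for two commuting fields. -/
theorem toFun_constField_comm {z : M} (hz : z ∈ e.source) (c d : Model p q) :
    D.toFun (F.bar (constField e c)) z (constField e d z) =
      D.toFun (F.bar (constField e d)) z (constField e c z) := by
  have h := hD e.source (constField e d) (constField e c) e.open_source
    (smoothVField_constField he.1 d) (smoothVField_constField he.1 c) z hz
  rw [← sub_eq_zero]
  refine h.trans ?_
  simp only [Foliation.bar, mlieBracket_constField he.1 hz, map_zero]

/-- Extend `v` to a constant-coefficient field tangent to the leaves. Torsion-freeness exchanges it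
with the other field, and its class in the normal bundle is zero on the whole chart domain. -/
theorem toFun_bar_constField_of_mem_tangent {z : M} (hz : z ∈ e.source) (c : Model p q)
    {v : TangentSpace (mdl p q) z} (hv : v ∈ F.tangent z) :
    D.toFun (F.bar (constField e c)) z v = 0 := by
  obtain ⟨d, rfl, hd⟩ : ∃ d : Model p q, constField e d z = v ∧ d.2 = 0 :=
    ⟨mfderiv (mdl p q) (mdl p q) e z v,
      (isInvertible_mfderiv_chart he.1 hz).inverse_apply_self v, (he.2 z hz v).1 hv⟩
  rw [toFun_constField_comm he hD hz]
  have h0 : ∀ w ∈ e.source, F.bar (constField e d) w = 0 := fun w hw => by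
    rw [Foliation.bar, Submodule.mkQ_apply, Submodule.Quotient.mk_eq_zero,
      constField_mem_tangent he hw]
    exact hd
  rw [D.toFun_eq_zero e.open_source h0 hz, LinearMap.zero_apply]

/-- The chosen lift differs from `∂/∂y^j` by a vector tangent to the leaves, which the derivative of
a frame section does not see. -/
theorem toFun_lift_bar {z : M} (hz : z ∈ e.source) (j l : Fin q) :
    D.toFun (F.bar (coordField e l)) z (F.lift z (F.bar (coordField e j) z)) =
      D.toFun (F.bar (coordField e l)) z (coordField e j z) := by
  rw [← sub_eq_zero, ← map_sub]
  refine toFun_bar_constField_of_mem_tangent he hD hz _ ?_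
  rw [← Submodule.Quotient.mk_eq_zero, ← Submodule.mkQ_apply, map_sub, F.mkQ_lift, Foliation.bar,
    sub_self]

end NormalConnection

end Adapted

end FoliatedHessian

namespace FoliatedHessian

variable {p q : ℕ} {M : Type*} [TopologicalSpace M] [ChartedSpace (Model p q) M]

/-! ### Product rules for partial derivatives in a chart -/

theorem pderiv_sum_mul {ι : Type*} [Fintype ι] {e : OpenPartialHomeomorph M (Model p q)}
    (he : e ∈ IsManifold.maximalAtlas (mdl p q) ∞ M) {f h : ι → M → ℝ}
    (hf : ∀ i, ContMDiffOn (mdl p q) 𝓘(ℝ, ℝ) ∞ (f i) e.source)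
    (hh : ∀ i, ContMDiffOn (mdl p q) 𝓘(ℝ, ℝ) ∞ (h i) e.source)
    {z : M} (hz : z ∈ e.source) (k : Fin q) :
    pderiv e k (fun w => ∑ i, f i w * h i w) z =
      ∑ i, (f i z * pderiv e k (h i) z + pderiv e k (f i) z * h i z) := by
  have hd {f : M → ℝ} (hf : ContMDiffOn (mdl p q) 𝓘(ℝ, ℝ) ∞ f e.source) :
      HasFDerivAt (f ∘ e.symm) (fderiv ℝ (f ∘ e.symm) (e z)) (e z) :=
    (((contDiffOn_comp_symm he hf).contDiffAt
      (e.open_target.mem_nhds (e.map_source hz))).differentiableAt (by simp)).hasFDerivAt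
  have h1 := HasFDerivAt.fun_sum (u := Finset.univ) fun i _ => (hd (hf i)).mul (hd (hh i))
  have h2 : (fun w => ∑ i, f i w * h i w) ∘ e.symm =
      fun x => ∑ i, ((f i ∘ e.symm) * (h i ∘ e.symm)) x := rfl
  simp only [pderiv, h2, h1.fderiv]
  simp [e.left_inv hz, mul_comm]

theorem pderiv_const_mul {e : OpenPartialHomeomorph M (Model p q)}
    (he : e ∈ IsManifold.maximalAtlas (mdl p q) ∞ M) {f : M → ℝ} (c : ℝ)
    (hf : ContMDiffOn (mdl p q) 𝓘(ℝ, ℝ) ∞ f e.source)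
    {z : M} (hz : z ∈ e.source) (k : Fin q) :
    pderiv e k (fun w => c * f w) z = c * pderiv e k f z := by
  have hd : DifferentiableAt ℝ (f ∘ e.symm) (e z) :=
    ((contDiffOn_comp_symm he hf).contDiffAt
      (e.open_target.mem_nhds (e.map_source hz))).differentiableAt (by simp)
  have h2 : (fun w => c * f w) ∘ e.symm = fun x => c * (f ∘ e.symm) x := rfl
  simp only [pderiv, h2, fderiv_const_mul hd]
  simp

variable [IsManifold (mdl p q) ∞ M] {F : Foliation p q M}

/-! ### A normal metric in an adapted chart -/

namespace NormalMetric

variable (g : NormalMetric F) {e : OpenPartialHomeomorph M (Model p q)} (he : F.IsAdapted e)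

theorem comp_symm (e : OpenPartialHomeomorph M (Model p q)) (i j : Fin q) (z : M) :
    g.comp e i j z = g.comp e j i z :=
  g.symm z _ _

theorem compInv_symm (e : OpenPartialHomeomorph M (Model p q)) (r s : Fin q) (z : M) :
    g.compInv e r s z = g.compInv e s r z := by
  have h : (Matrix.of fun i j => g.comp e i j z).transpose = Matrix.of fun i j => g.comp e i j z :=
    Matrix.ext fun i j => g.comp_symm e j i z
  have h2 := Matrix.transpose_nonsing_inv (Matrix.of fun i j => g.comp e i j z)
  rw [h] at h2
  exact congrFun (congrFun h2 s) r

include he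

theorem contMDiffOn_comp (i j : Fin q) :
    ContMDiffOn (mdl p q) 𝓘(ℝ, ℝ) ∞ (g.comp e i j) e.source :=
  g.smooth e.source _ _ e.open_source (smoothSection_bar_coordField he i)
    (smoothSection_bar_coordField he j)

/-- A kernel vector `b` would give a normal vector `∑ b_i ∂/∂y^i` of zero length. By positivity that
vector is zero, and then `b = 0` by independence of the frame. -/
theorem det_comp_ne_zero {z : M} (hz : z ∈ e.source) :
    (Matrix.of fun i j => g.comp e i j z).det ≠ 0 := by
  intro h
  obtain ⟨b, hb, hb0⟩ := Matrix.exists_mulVec_eq_zero_iff.2 h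
  refine hb (eq_zero_of_sum_bar_eq_zero he hz ?_)
  by_contra hne
  refine (g.pos z _ hne).ne' ?_
  have h1 : ∀ i, ∑ j, b j * g.toFun z (F.bar (coordField e j) z) (F.bar (coordField e i) z) = 0 :=
    fun i => by
      have := congrFun hb0 i
      simpa [Matrix.mulVec, dotProduct, comp, mul_comm, g.symm z (F.bar (coordField e i) z)]
        using this
  simp [map_sum, LinearMap.sum_apply, h1]

theorem sum_comp_mul_compInv {z : M} (hz : z ∈ e.source) (i : Fin q) (v : Fin q → ℝ) :
    ∑ m, g.comp e i m z * ∑ r, g.compInv e m r z * v r = v i := by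
  have h := Matrix.mul_nonsing_inv (Matrix.of fun i j => g.comp e i j z)
    (isUnit_iff_ne_zero.2 (g.det_comp_ne_zero he hz))
  have h2 := congrFun (congrArg (fun A => A.mulVec v) h) i
  rw [← Matrix.mulVec_mulVec, Matrix.one_mulVec] at h2
  exact h2

/-- Cramer's rule: the entries of the inverse are cofactors divided by a nonvanishing determinant,
and determinants are polynomials in the entries. -/
theorem contMDiffOn_compInv (r s : Fin q) :
    ContMDiffOn (mdl p q) 𝓘(ℝ, ℝ) ∞ (g.compInv e r s) e.source := by
  have hdet {f : M → Matrix (Fin q) (Fin q) ℝ}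
      (hf : ∀ i j, ContMDiffOn (mdl p q) 𝓘(ℝ, ℝ) ∞ (fun w => f w i j) e.source) :
      ContMDiffOn (mdl p q) 𝓘(ℝ, ℝ) ∞ (fun w => (f w).det) e.source := by
    simp only [Matrix.det_apply']
    exact contMDiffOn_finsetSum fun σ _ => contMDiffOn_const.mul (contMDiffOn_finsetProd fun i _ => hf _ _)
  have h1 : g.compInv e r s = fun z => (Matrix.of fun i j => g.comp e i j z).det⁻¹ *
      (Matrix.of fun i j => g.comp e i j z).adjugate r s := by
    funext z
    simp [compInv, Matrix.inv_def]
  rw [h1]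
  refine ContMDiffOn.mul (ContMDiffOn.inv₀ (hdet fun i j => ?_) fun z hz =>
    g.det_comp_ne_zero he hz) ?_
  · exact g.contMDiffOn_comp he i j
  · simp only [Matrix.adjugate_apply]
    refine hdet fun i j => ?_
    by_cases hi : i = s
    · subst hi
      simpa using contMDiffOn_const
    · simpa [Matrix.updateRow_ne hi] using g.contMDiffOn_comp he i j

/-- Nondegeneracy of `g`: `u - v` is orthogonal to a spanning set, hence to itself. -/
theorem eq_of_forall_bar {z : M} (hz : z ∈ e.source) {u v : F.Normal z}
    (h : ∀ i, g.toFun z (F.bar (coordField e i) z) u = g.toFun z (F.bar (coordField e i) z) v) :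
    u = v := by
  rw [← sub_eq_zero]
  by_contra hne
  refine (g.pos z _ hne).ne' ?_
  obtain ⟨b, hb⟩ := exists_eq_sum_bar he hz (u - v)
  have h' : ∀ i, g.toFun z (F.bar (coordField e i) z) (u - v) = 0 := fun i => by
    rw [map_sub, h i, sub_self]
  calc g.toFun z (u - v) (u - v)
      = g.toFun z (∑ i, b i • F.bar (coordField e i) z) (u - v) := by rw [← hb]
    _ = 0 := by
      rw [map_sum, LinearMap.sum_apply]
      exact Finset.sum_eq_zero fun i _ => by
        rw [map_smul, LinearMap.smul_apply, h' i, smul_zero]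

end NormalMetric

/-! ### Higher derivatives of a potential -/

section Potential

variable {e : OpenPartialHomeomorph M (Model p q)}
  (he : e ∈ IsManifold.maximalAtlas (mdl p q) ∞ M) {φ : M → ℝ}
  (hφ : ContMDiffOn (mdl p q) 𝓘(ℝ, ℝ) ∞ φ e.source)

include he hφ
omit [IsManifold (mdl p q) ∞ M]

theorem pderiv_pderiv_comm {z : M} (hz : z ∈ e.source) (i j k : Fin q) :
    pderiv e i (pderiv e j (pderiv e k φ)) z = pderiv e i (pderiv e k (pderiv e j φ)) z :=
  pderiv_congr (fun _ hw => pderiv_comm he hφ hw j k) hz i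

theorem pderiv_pderiv_pderiv_comm {z : M} (hz : z ∈ e.source) (i j k l : Fin q) :
    pderiv e i (pderiv e j (pderiv e k (pderiv e l φ))) z =
      pderiv e i (pderiv e j (pderiv e l (pderiv e k φ))) z :=
  pderiv_congr (fun _ hw => pderiv_pderiv_comm he hφ hw j k l) hz i

end Potential

end FoliatedHessian

namespace FoliatedHessian

variable {p q : ℕ} {M : Type*} [TopologicalSpace M] [ChartedSpace (Model p q) M]
  [IsManifold (mdl p q) ∞ M] {F : Foliation p q M} {g : NormalMetric F}
  {nabla : NormalConnection F} {e : OpenPartialHomeomorph M (Model p q)} {φ : M → ℝ}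

/-! ### The Levi-Civita connection of a Hessian metric -/

/-- The Christoffel symbols `½ g^{mr} ∂³φ / ∂y^j ∂y^l ∂y^r` of the metric with potential `φ`. -/
noncomputable def christoffel (g : NormalMetric F) (e : OpenPartialHomeomorph M (Model p q))
    (φ : M → ℝ) (m j l : Fin q) : M → ℝ :=
  fun w => ∑ r, g.compInv e m r w * ((1 / 2) * pderiv e j (pderiv e l (pderiv e r φ)) w)

theorem contMDiffOn_half_pderiv (he : F.IsAdapted e)
    (hφ : ContMDiffOn (mdl p q) 𝓘(ℝ, ℝ) ∞ φ e.source) (j l i : Fin q) :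
    ContMDiffOn (mdl p q) 𝓘(ℝ, ℝ) ∞
      (fun w => (1 / 2) * pderiv e j (pderiv e l (pderiv e i φ)) w) e.source :=
  contMDiffOn_const.mul
    (contMDiffOn_pderiv he.1 (contMDiffOn_pderiv he.1 (contMDiffOn_pderiv he.1 hφ i) l) j)

theorem contMDiffOn_christoffel (he : F.IsAdapted e)
    (hφ : ContMDiffOn (mdl p q) 𝓘(ℝ, ℝ) ∞ φ e.source) (m j l : Fin q) :
    ContMDiffOn (mdl p q) 𝓘(ℝ, ℝ) ∞ (christoffel g e φ m j l) e.source :=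
  contMDiffOn_finsetSum fun r _ =>
    (g.contMDiffOn_compInv he m r).mul (contMDiffOn_half_pderiv he hφ j l r)

theorem sum_comp_mul_christoffel (he : F.IsAdapted e) {z : M} (hz : z ∈ e.source)
    (i j l : Fin q) :
    ∑ m, g.comp e i m z * christoffel g e φ m j l z =
      (1 / 2) * pderiv e j (pderiv e l (pderiv e i φ)) z :=
  g.sum_comp_mul_compInv he hz i fun r => (1 / 2) * pderiv e j (pderiv e l (pderiv e r φ)) z

/-- The Koszul argument. Metric compatibility in three index orders has the same left side each
time, since `∂_k g_ij = φ_kij` is fully symmetric. -/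
theorem metric_leviCivita_coordField (hnabla : nabla.IsLeviCivita g) (he : F.IsAdapted e)
    (hφ : g.IsPotential e φ) {z : M} (hz : z ∈ e.source) (i j l : Fin q) :
    g.toFun z (F.bar (coordField e i) z)
        (nabla.toFun (F.bar (coordField e l)) z (coordField e j z)) =
      (1 / 2) * pderiv e j (pderiv e l (pderiv e i φ)) z := by
  have hs (i : Fin q) := smoothSection_bar_coordField he i
  have hcomm (i j l : Fin q) : g.toFun z (F.bar (coordField e i) z)
        (nabla.toFun (F.bar (coordField e l)) z (coordField e j z)) =
      g.toFun z (F.bar (coordField e i) z)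
        (nabla.toFun (F.bar (coordField e j)) z (coordField e l z)) :=
    congrArg _ (NormalConnection.toFun_constField_comm he hnabla.1 hz _ _)
  have hmetric (k i j : Fin q) : pderiv e k (pderiv e i (pderiv e j φ)) z =
      g.toFun z (F.bar (coordField e j) z)
          (nabla.toFun (F.bar (coordField e i)) z (coordField e k z)) +
        g.toFun z (F.bar (coordField e i) z)
          (nabla.toFun (F.bar (coordField e j)) z (coordField e k z)) := by
    have h := hnabla.2 e.source _ _ e.open_source (hs i) (hs j) z hz (coordField e k z)
    rw [g.symm z _ (F.bar (coordField e j) z)] at h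
    rw [← h, ← pderiv_congr (fun w hw => hφ.2 w hw i j) hz k]
    exact (mvfderiv_coordField he.1 (g.contMDiffOn_comp he i j) hz k).symm
  have h1 := hmetric j l i
  have h2 := hmetric l j i
  have h3 := hmetric i j l
  rw [pderiv_comm he.1 (contMDiffOn_pderiv he.1 hφ.1.1 i) hz l j] at h2
  rw [pderiv_pderiv_comm he.1 hφ.1.1 hz i j l,
    pderiv_comm he.1 (contMDiffOn_pderiv he.1 hφ.1.1 j) hz i l,
    pderiv_pderiv_comm he.1 hφ.1.1 hz l i j,
    pderiv_comm he.1 (contMDiffOn_pderiv he.1 hφ.1.1 i) hz l j] at h3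
  -- The combination `h1 + h2 - h3`: torsion-freeness cancels the terms paired with `∂/∂y^j` and
  -- `∂/∂y^l`, leaving twice the required product.
  linarith [hcomm i j l, hcomm j i l, hcomm l i j]

theorem leviCivita_coordField_eq_sum (hnabla : nabla.IsLeviCivita g) (he : F.IsAdapted e)
    (hφ : g.IsPotential e φ) {z : M} (hz : z ∈ e.source) (j l : Fin q) :
    nabla.toFun (F.bar (coordField e l)) z (coordField e j z) =
      ∑ m, christoffel g e φ m j l z • F.bar (coordField e m) z := by
  refine g.eq_of_forall_bar he hz fun i => ?_
  rw [metric_leviCivita_coordField hnabla he hφ hz, ← sum_comp_mul_christoffel (g := g) he hz,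
    map_sum]
  refine Finset.sum_congr rfl fun m _ => ?_
  rw [map_smul, smul_eq_mul, mul_comm, NormalMetric.comp]

/-! ### The Hessian curvature tensor in an affine chart -/

variable {D : NormalConnection F}

theorem differenceTensor_bar_coordField (hD : D.IsAffineChart e) (hnabla : nabla.IsLeviCivita g)
    (hφ : g.IsPotential e φ) {z : M} (hz : z ∈ e.source) (j l : Fin q) :
    differenceTensor D nabla (F.bar (coordField e j)) (F.bar (coordField e l)) z =
      ∑ m, christoffel g e φ m j l z • F.bar (coordField e m) z := by
  rw [differenceTensor, hD.2 l z hz, LinearMap.zero_apply, sub_zero,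
    NormalConnection.toFun_lift_bar hD.1 hnabla.1 hz,
    leviCivita_coordField_eq_sum hnabla hD.1 hφ hz]

theorem hessianCurvature_coordField (hD : D.IsAffineChart e) (hnabla : nabla.IsLeviCivita g)
    (hφ : g.IsPotential e φ) {z : M} (hz : z ∈ e.source) (j k l : Fin q) :
    hessianCurvature D nabla (coordField e k) (F.bar (coordField e j)) (F.bar (coordField e l)) z =
      ∑ m, pderiv e k (christoffel g e φ m j l) z • F.bar (coordField e m) z := by
  have hc (m : Fin q) := contMDiffOn_christoffel (g := g) hD.1 hφ.1.1 m j l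
  have hX (m : Fin q) := smoothVField_coordField hD.1.1 m
  have hpar (l : Fin q) : ∀ w ∈ e.source,
      D.along (coordField e k) (F.bar (coordField e l)) w = 0 := fun w hw => by
    rw [NormalConnection.along, hD.2 l w hw, LinearMap.zero_apply]
  have h1 : D.along (coordField e k) (differenceTensor D nabla (F.bar (coordField e j))
      (F.bar (coordField e l))) z =
      ∑ m, pderiv e k (christoffel g e φ m j l) z • F.bar (coordField e m) z := by
    rw [NormalConnection.along, D.toFun_congr e.open_source
      (Foliation.smoothSection_sum e.open_source Finset.univ hc hX)
      (fun w hw => differenceTensor_bar_coordField hD hnabla hφ hw j l) hz,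
      D.toFun_sum e.open_source Finset.univ hc hX hz]
    refine Finset.sum_congr rfl fun m _ => ?_
    rw [hD.2 m z hz, LinearMap.zero_apply, smul_zero, add_zero,
      mvfderiv_coordField hD.1.1 (hc m) hz]
  -- The first argument of `γ` enters pointwise, so its vanishing at `z` suffices here. The second
  -- is differentiated, so `h3` needs vanishing on an open set.
  have h2 : differenceTensor D nabla (D.along (coordField e k) (F.bar (coordField e j)))
      (F.bar (coordField e l)) z = 0 := by
    rw [differenceTensor, hpar j z hz]
    simp only [map_zero, sub_zero]
  have h3 : differenceTensor D nabla (F.bar (coordField e j))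
      (D.along (coordField e k) (F.bar (coordField e l))) z = 0 := by
    rw [differenceTensor, D.toFun_eq_zero e.open_source (hpar l) hz,
      nabla.toFun_eq_zero e.open_source (hpar l) hz]
    simp only [LinearMap.zero_apply, sub_zero]
  rw [hessianCurvature, h1, h2, h3, sub_zero, sub_zero]

theorem hessianCurvatureComp_eq (hD : D.IsAffineChart e) (hnabla : nabla.IsLeviCivita g)
    (hφ : g.IsPotential e φ) {z : M} (hz : z ∈ e.source) (i j k l : Fin q) :
    hessianCurvatureComp g D nabla e i j k l z =
      (1 / 2) * pderiv e k (pderiv e j (pderiv e l (pderiv e i φ))) z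
      - (1 / 2) * ∑ r, ∑ s, g.compInv e r s z *
          pderiv e k (pderiv e i (pderiv e r φ)) z *
          pderiv e j (pderiv e l (pderiv e s φ)) z := by
  have h1 : hessianCurvatureComp g D nabla e i j k l z =
      ∑ m, g.comp e i m z * pderiv e k (christoffel g e φ m j l) z := by
    rw [hessianCurvatureComp, hessianCurvature_coordField hD hnabla hφ hz, map_sum]
    refine Finset.sum_congr rfl fun m _ => ?_
    rw [map_smul, smul_eq_mul, mul_comm, NormalMetric.comp]
  -- Differentiate `g_im Γ^m_jl` as a product. It equals `½ φ_jli` on the whole chart domain, so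
  -- both sides may be differentiated.
  have h2 := pderiv_sum_mul hD.1.1 (fun m => g.contMDiffOn_comp hD.1 i m)
    (fun m => contMDiffOn_christoffel (g := g) hD.1 hφ.1.1 m j l) hz k
  rw [pderiv_congr (fun w hw => sum_comp_mul_christoffel hD.1 hw i j l) hz k,
    pderiv_const_mul hD.1.1 _ (contMDiffOn_pderiv hD.1.1 (contMDiffOn_pderiv hD.1.1
      (contMDiffOn_pderiv hD.1.1 hφ.1.1 i) l) j) hz, Finset.sum_add_distrib, ← h1] at h2
  -- The term where the derivative falls on the metric: `∂_k g_im = φ_kim`, and expanding `Γ^m_jl`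
  -- produces the quadratic expression.
  have h3 : ∑ m, pderiv e k (g.comp e i m) z * christoffel g e φ m j l z =
      (1 / 2) * ∑ r, ∑ s, g.compInv e r s z * pderiv e k (pderiv e i (pderiv e r φ)) z *
          pderiv e j (pderiv e l (pderiv e s φ)) z := by
    rw [Finset.mul_sum]
    refine Finset.sum_congr rfl fun m _ => ?_
    rw [pderiv_congr (fun w hw => hφ.2 w hw i m) hz k, christoffel, Finset.mul_sum, Finset.mul_sum]
    exact Finset.sum_congr rfl fun s _ => by ring
  rw [h3] at h2
  linarith

end FoliatedHessian

/-! ### The curvature formula and its symmetries -/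

open FoliatedHessian in
theorem mainTheorem7 {p q : ℕ} {M : Type*} [TopologicalSpace M] [ChartedSpace (Model p q) M]
    [IsManifold (mdl p q) ∞ M] (F : Foliation p q M) (S : HessianStructure F)
    (nabla : NormalConnection F) (hnabla : nabla.IsLeviCivita S.g)
    (e : OpenPartialHomeomorph M (Model p q)) (he : S.D.IsAffineChart e)
    (φ : M → ℝ) (hφ : S.g.IsPotential e φ) :
    (∀ z ∈ e.source, ∀ i j k l : Fin q,
      hessianCurvatureComp S.g S.D nabla e i j k l z =
        (1 / 2) * pderiv e i (pderiv e j (pderiv e k (pderiv e l φ))) z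
        - (1 / 2) * ∑ r, ∑ s, S.g.compInv e r s z *
            pderiv e i (pderiv e k (pderiv e r φ)) z *
            pderiv e j (pderiv e l (pderiv e s φ)) z) ∧
    (∀ z ∈ e.source, ∀ i j k l : Fin q,
      hessianCurvatureComp S.g S.D nabla e i j k l z
          = hessianCurvatureComp S.g S.D nabla e k l i j z ∧
      hessianCurvatureComp S.g S.D nabla e k l i j z
          = hessianCurvatureComp S.g S.D nabla e k j i l z ∧
      hessianCurvatureComp S.g S.D nabla e k j i l z
          = hessianCurvatureComp S.g S.D nabla e i l k j z ∧
      hessianCurvatureComp S.g S.D nabla e i l k j z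
          = hessianCurvatureComp S.g S.D nabla e j i l k z) := by
  have hA := he.1.1
  have h0 := hφ.1.1
  have h12 {z : M} (hz : z ∈ e.source) (i j k l : Fin q) :=
    pderiv_comm hA (contMDiffOn_pderiv hA (contMDiffOn_pderiv hA h0 l) k) hz i j
  have h23 {z : M} (hz : z ∈ e.source) (i j k l : Fin q) :=
    pderiv_pderiv_comm hA (contMDiffOn_pderiv hA h0 l) hz i j k
  have h34 {z : M} (hz : z ∈ e.source) := pderiv_pderiv_pderiv_comm hA h0 hz
  have h3 {z : M} (hz : z ∈ e.source) (i j k : Fin q) :=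
    pderiv_comm hA (contMDiffOn_pderiv hA h0 k) hz i j
  have key : ∀ z ∈ e.source, ∀ i j k l : Fin q,
      hessianCurvatureComp S.g S.D nabla e i j k l z =
        (1 / 2) * pderiv e i (pderiv e j (pderiv e k (pderiv e l φ))) z
        - (1 / 2) * ∑ r, ∑ s, S.g.compInv e r s z *
            pderiv e i (pderiv e k (pderiv e r φ)) z *
            pderiv e j (pderiv e l (pderiv e s φ)) z := by
    intro z hz i j k l
    rw [hessianCurvatureComp_eq he hnabla hφ hz, h34 hz k j l i, h23 hz k j i l, h12 hz k i j l,
      h23 hz i k j l]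
    simp only [h3 hz k i]
  refine ⟨key, fun z hz i j k l => ?_⟩
  -- All the index orders in (2) preserve the partition into `{i, k}` and `{j, l}`. Order within a
  -- pair is handled by commuting derivatives, and exchanging the pairs by the symmetry of `g^{rs}`.
  have hsw : ∑ r, ∑ s, S.g.compInv e r s z * pderiv e i (pderiv e k (pderiv e r φ)) z *
        pderiv e j (pderiv e l (pderiv e s φ)) z =
      ∑ r, ∑ s, S.g.compInv e r s z * pderiv e j (pderiv e l (pderiv e r φ)) z *
        pderiv e i (pderiv e k (pderiv e s φ)) z := by
    rw [Finset.sum_comm]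
    refine Finset.sum_congr rfl fun r _ => Finset.sum_congr rfl fun s _ => ?_
    rw [S.g.compInv_symm e s r]
    ring
  simp only [key z hz, h3 hz k i, h3 hz l j, ← hsw]
  -- The quadratic terms now all agree; only reorderings of the fourth derivative of `φ` remain.
  generalize ∑ r, ∑ s, S.g.compInv e r s z * pderiv e i (pderiv e k (pderiv e r φ)) z *
    pderiv e j (pderiv e l (pderiv e s φ)) z = c
  refine ⟨?_, ?_, ?_, ?_⟩ <;> congr 2
  · rw [h23 hz i j k l, h12 hz i k j l, h34 hz k i j l, h23 hz k i l j]
  · rw [h34 hz k l i j, h23 hz k l j i, h34 hz k j l i]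
  · rw [h12 hz k j i l, h23 hz j k i l, h12 hz j i k l, h34 hz i j k l, h23 hz i j l k,
      h34 hz i l j k]
  · rw [h34 hz i l k j, h23 hz i l j k, h12 hz i j l k]
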